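/- Let $M$ be a smooth $3$-dimensional manifold with a Riemannian metric $g$ and an almost contact metric structure $(\phi,\xi,\eta,g)$: $\phi$ is a smooth $(1,1)$-tensor field, $\xi$ a smooth vector field and $\eta$ a smooth $1$-form with $$\phi^2X=-X+\eta(X)\xi,\qquad \eta(\xi)=1,\qquad \phi\xi=0,\qquad \eta\circ\phi=0,\qquad g(\phi X,\phi Y)=g(X,Y)-\eta(X)\eta(Y).$$ Suppose that the structure is normal, i.e. $[\phi,\phi]+2\,d\eta\otimes\xi=0$, where $[\phi,\phi](X,Y)=\phi^2[X,Y]+[\phi X,\phi Y]-\phi[\phi X,Y]-\phi[X,\phi Y]$ and $2\,d\eta(X,Y)=X\eta(Y)-Y\eta(X)-\eta([X,Y])$, and that it is not cosymplectic (cosymplectic means: normal with $\eta$ and $\Phi(X,Y)=g(X,\phi Y)$ both closed). Let $\nabla$ be the Levi-Civita connection of $g$, and suppose that the functions $\alpha=\tfrac12\operatorname{div}\xi=\tfrac12\operatorname{tr}(X\mapsto\nabla_X\xi)$ and $\beta=\tfrac12\operatorname{tr}(X\mapsto\phi\nabla_X\xi)$ are constant on $M$. Suppose that $g$ is an almost Riemann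 soliton with potential vector field $\xi$, i.e. there is a smooth function $\lambda$ on $M$ such that $$2R+\lambda\, g\circledast g+g\circledast \mathcal L_\xi g=0,$$ where $R(X,Y,Z,W)=g(R(X,Y)Z,W)$ with $R(X,Y)Z=\nabla_X\nabla_YZ-\nabla_Y\nabla_XZ-\nabla_{[X,Y]}Z$, and $\circledast$ is the Kulkarni-Nomizu product $$(P\circledast Q)(X,Y,Z,W)=P(X,W)Q(Y,Z)+P(Y,Z)Q(X,W)-P(X,Z)Q(Y,W)-P(Y,W)Q(X,Z).$$ Then the almost Riemann soliton is a Riemann soliton: $\lambda$ is constant on $M$, and $g$ satisfies the displayed equation with that constant. -/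

import Mathlib

open Bundle VectorField
open scoped Manifold ContDiff

noncomputable section

namespace AlmostContact

section Connection

variable {E : Type*} [NormedAddCommGroup E] [NormedSpace ℝ E] [FiniteDimensional ℝ E]
  {H : Type*} [TopologicalSpace H] (I : ModelWithCorners ℝ E H)
  {M : Type*} [TopologicalSpace M] [ChartedSpace H M] [IsManifold I ∞ M]
  [RiemannianBundle (fun x : M ↦ TangentSpace I x)]
  [IsContMDiffRiemannianBundle I ∞ E (fun x : M ↦ TangentSpace I x)]

/-- The function `g(X, Y)` of two vector fields; the Riemannian metric `g` of `M` is the inner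
product on the tangent spaces, which varies smoothly with the base point. -/
def metricTensor (X Y : Π x : M, TangentSpace I x) (x : M) : ℝ := inner ℝ (X x) (Y x)

/-- The right-hand side of the Koszul formula for `g(∇_X Y, Z)`. -/
def koszul (X Y Z : Π x : M, TangentSpace I x) (x : M) : ℝ :=
  (1 / 2 : ℝ) * (mvfderiv I (metricTensor I Y Z) x (X x) + mvfderiv I (metricTensor I X Z) x (Y x)
    - mvfderiv I (metricTensor I X Y) x (Z x)
    + inner ℝ (mlieBracket I X Y x) (Z x) - inner ℝ (mlieBracket I X Z x) (Y x)
    - inner ℝ (mlieBracket I Y Z x) (X x))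

variable {I}

theorem mdiffAt_metricTensor {X Y : Π x : M, TangentSpace I x} {x : M}
    (hX : MDiffAt (T% X) x) (hY : MDiffAt (T% Y) x) : MDiffAt (metricTensor I X Y) x :=
  MDifferentiableAt.inner_bundle (E := fun x : M ↦ TangentSpace I x) hX hY

theorem metricTensor_comm (X Y : Π x : M, TangentSpace I x) :
    metricTensor I X Y = metricTensor I Y X := by
  ext x; exact real_inner_comm _ _

theorem metricTensor_smul_left (f : M → ℝ) (X Y : Π x : M, TangentSpace I x) :
    metricTensor I (f • X) Y = f * metricTensor I X Y := by
  ext x; simp [metricTensor, inner_smul_left]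

theorem metricTensor_smul_right (f : M → ℝ) (X Y : Π x : M, TangentSpace I x) :
    metricTensor I X (f • Y) = f * metricTensor I X Y := by
  ext x; simp [metricTensor, inner_smul_right]

theorem metricTensor_add_left (X X' Y : Π x : M, TangentSpace I x) :
    metricTensor I (X + X') Y = metricTensor I X Y + metricTensor I X' Y := by
  ext x; simp [metricTensor, inner_add_left]

theorem metricTensor_add_right (X Y Y' : Π x : M, TangentSpace I x) :
    metricTensor I X (Y + Y') = metricTensor I X Y + metricTensor I X Y' := by
  ext x; simp [metricTensor, inner_add_right]

theorem koszul_tensorial_left {Y Z : Π x : M, TangentSpace I x} {x : M}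
    (hY : MDiffAt (T% Y) x) (hZ : MDiffAt (T% Z) x) :
    TensorialAt I E (fun X : Π x : M, TangentSpace I x ↦ koszul I X Y Z x) x where
  smul {f X} hf hX := by
    have h1 := mdiffAt_metricTensor hX hY
    have h2 := mdiffAt_metricTensor hX hZ
    simp [koszul, metricTensor_smul_left, mvfderiv_mul hf h1, mvfderiv_mul hf h2,
      mlieBracket_smul_left hf hX, inner_add_left, inner_smul_left, inner_smul_right]
    simp [metricTensor, real_inner_comm]
    ring
  add {X X'} hX hX' := by
    simp [koszul, metricTensor_add_left,
      mvfderiv_add (mdiffAt_metricTensor hX hY) (mdiffAt_metricTensor hX' hY),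
      mvfderiv_add (mdiffAt_metricTensor hX hZ) (mdiffAt_metricTensor hX' hZ),
      mlieBracket_add_left hX hX', inner_add_left, inner_add_right]
    ring

theorem koszul_tensorial_right {X Y : Π x : M, TangentSpace I x} {x : M}
    (hX : MDiffAt (T% X) x) (hY : MDiffAt (T% Y) x) :
    TensorialAt I E (fun Z : Π x : M, TangentSpace I x ↦ koszul I X Y Z x) x where
  smul {f Z} hf hZ := by
    have h1 := mdiffAt_metricTensor hX hZ
    have h2 := mdiffAt_metricTensor hY hZ
    simp [koszul, metricTensor_smul_right, mvfderiv_mul hf h1, mvfderiv_mul hf h2,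
      mlieBracket_smul_right hf hZ, inner_add_left, inner_smul_left, inner_smul_right]
    simp [metricTensor, real_inner_comm]
    ring
  add {Z Z'} hZ hZ' := by
    simp [koszul, metricTensor_add_right,
      mvfderiv_add (mdiffAt_metricTensor hX hZ) (mdiffAt_metricTensor hX hZ'),
      mvfderiv_add (mdiffAt_metricTensor hY hZ) (mdiffAt_metricTensor hY hZ'),
      mlieBracket_add_right hZ hZ', inner_add_left, inner_add_right]
    ring

theorem koszul_add {X Y Y' Z : Π x : M, TangentSpace I x} {x : M}
    (hX : MDiffAt (T% X) x) (hY : MDiffAt (T% Y) x) (hY' : MDiffAt (T% Y') x)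
    (hZ : MDiffAt (T% Z) x) :
    koszul I X (Y + Y') Z x = koszul I X Y Z x + koszul I X Y' Z x := by
  simp [koszul, metricTensor_add_right, metricTensor_add_left,
    mvfderiv_add (mdiffAt_metricTensor hX hY) (mdiffAt_metricTensor hX hY'),
    mvfderiv_add (mdiffAt_metricTensor hY hZ) (mdiffAt_metricTensor hY' hZ),
    mlieBracket_add_right hY hY', mlieBracket_add_left hY hY', inner_add_left, inner_add_right]
  ring

theorem koszul_leibniz {X Y Z : Π x : M, TangentSpace I x} {f : M → ℝ} {x : M}
    (hX : MDiffAt (T% X) x) (hY : MDiffAt (T% Y) x) (hZ : MDiffAt (T% Z) x) (hf : MDiffAt f x) :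
    koszul I X (f • Y) Z x =
      f x * koszul I X Y Z x + mvfderiv I f x (X x) * inner ℝ (Y x) (Z x) := by
  simp [koszul, metricTensor_smul_right, metricTensor_smul_left,
    mvfderiv_mul hf (mdiffAt_metricTensor hX hY), mvfderiv_mul hf (mdiffAt_metricTensor hY hZ),
    mlieBracket_smul_right hf hY, mlieBracket_smul_left hf hY, inner_add_left, inner_smul_left,
    inner_smul_right]
  simp [metricTensor, real_inner_comm]
  ring



/-- The Koszul formula of a vector field `Y` differentiable at `x`, as a bilinear form on `T_xM`. -/
def koszulForm {Y : Π x : M, TangentSpace I x} {x : M} (hY : MDiffAt (T% Y) x) :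
    TangentSpace I x →L[ℝ] TangentSpace I x →L[ℝ] ℝ :=
  TensorialAt.mkHom₂ (fun X Z ↦ koszul I X Y Z x) x
    (fun _ hZ ↦ koszul_tensorial_left hY hZ) (fun _ hX ↦ koszul_tensorial_right hX hY)

theorem koszulForm_apply {X Y Z : Π x : M, TangentSpace I x} {x : M} (hX : MDiffAt (T% X) x)
    (hY : MDiffAt (T% Y) x) (hZ : MDiffAt (T% Z) x) :
    koszulForm hY (X x) (Z x) = koszul I X Y Z x :=
  TensorialAt.mkHom₂_apply _ _ hX hZ

instance instFiniteDimensionalTangentSpace (x : M) : FiniteDimensional ℝ (TangentSpace I x) :=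
  inferInstanceAs (FiniteDimensional ℝ E)

instance instCompleteSpaceTangentSpace (x : M) : CompleteSpace (TangentSpace I x) :=
  FiniteDimensional.complete ℝ _

/-- The endomorphism of `T_xM` which represents a bilinear form through the metric. -/
def sharp {x : M} (B : TangentSpace I x →L[ℝ] TangentSpace I x →L[ℝ] ℝ) :
    TangentSpace I x →L[ℝ] TangentSpace I x :=
  LinearMap.toContinuousLinearMap
    { toFun := fun v ↦ (InnerProductSpace.toDual ℝ (TangentSpace I x)).symm (B v)
      map_add' := fun v w ↦ by simp
      map_smul' := fun c v ↦ by simp }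

theorem inner_sharp {x : M} (B : TangentSpace I x →L[ℝ] TangentSpace I x →L[ℝ] ℝ)
    (v w : TangentSpace I x) : inner ℝ (sharp B v) w = B v w :=
  InnerProductSpace.toDual_symm_apply

open Classical in
variable (I) in
/-- The vector `(∇_X Y)(x)`, as a function of `X(x)`, for `Y` differentiable at `x`: it is determined
by `g(∇_X Y, Z)` being given by the Koszul formula. -/
def leviCivitaFun (Y : Π x : M, TangentSpace I x) (x : M) :
    TangentSpace I x →L[ℝ] TangentSpace I x :=
  if hY : MDiffAt (T% Y) x then sharp (koszulForm hY) else 0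

theorem inner_leviCivitaFun {X Y Z : Π x : M, TangentSpace I x} {x : M} (hX : MDiffAt (T% X) x)
    (hY : MDiffAt (T% Y) x) (hZ : MDiffAt (T% Z) x) :
    inner ℝ (leviCivitaFun I Y x (X x)) (Z x) = koszul I X Y Z x := by
  rw [leviCivitaFun, dif_pos hY, inner_sharp, koszulForm_apply hX hY hZ]

theorem endomorphism_ext {x : M} {A B : TangentSpace I x →L[ℝ] TangentSpace I x}
    (h : ∀ X Z : Π x : M, TangentSpace I x, MDiffAt (T% X) x → MDiffAt (T% Z) x →
      (inner ℝ (A (X x)) (Z x) : ℝ) = inner ℝ (B (X x)) (Z x)) : A = B := by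
  ext v
  refine ext_inner_right ℝ fun w ↦ ?_
  simpa using h _ _ (FiberBundle.mdifferentiableAt_extend I E v)
    (FiberBundle.mdifferentiableAt_extend I E w)

variable (I M) in
/-- The Levi-Civita connection `∇` of the Riemannian metric of `M`. In Mathlib's order of arguments,
`leviCivita I M Y x (X x)` is `(∇_X Y)(x)`. It is torsion-free and metric, as is proved below. -/
def leviCivita : CovariantDerivative I E (fun x : M ↦ TangentSpace I x) where
  toFun := leviCivitaFun I
  isCovariantDerivativeOnUniv :=
    { add := fun {Y Y' x} hY hY' _ ↦ by
        refine endomorphism_ext fun X Z hX hZ ↦ ?_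
        rw [add_apply, inner_add_left,
          inner_leviCivitaFun hX (mdifferentiableAt_add_section hY hY') hZ,
          inner_leviCivitaFun hX hY hZ, inner_leviCivitaFun hX hY' hZ, koszul_add hX hY hY' hZ]
      leibniz := fun {Y f x} hY hf _ ↦ by
        refine endomorphism_ext fun X Z hX hZ ↦ ?_
        rw [add_apply, inner_add_left,
          inner_leviCivitaFun hX (hf.smul_section hY) hZ, smul_apply,
          inner_smul_left, inner_leviCivitaFun hX hY hZ, koszul_leibniz hX hY hZ hf,
          ContinuousLinearMap.smulRight_apply, inner_smul_left]
        rfl }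

theorem inner_leviCivita {X Y Z : Π x : M, TangentSpace I x} {x : M} (hX : MDiffAt (T% X) x)
    (hY : MDiffAt (T% Y) x) (hZ : MDiffAt (T% Z) x) :
    inner ℝ (leviCivita I M Y x (X x)) (Z x) = koszul I X Y Z x :=
  inner_leviCivitaFun hX hY hZ

theorem leviCivita_torsion_free {X Y : Π x : M, TangentSpace I x} {x : M}
    (hX : MDiffAt (T% X) x) (hY : MDiffAt (T% Y) x) :
    leviCivita I M Y x (X x) - leviCivita I M X x (Y x) = mlieBracket I X Y x := by
  refine ext_inner_right ℝ fun w ↦ ?_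
  have hZ := FiberBundle.mdifferentiableAt_extend I E w
  have h1 := inner_leviCivita hX hY hZ
  have h2 := inner_leviCivita hY hX hZ
  simp only [FiberBundle.extend_apply_self] at h1 h2
  rw [inner_sub_left, h1, h2, koszul, koszul, mlieBracket_swap_apply (V := Y) (W := X),
    metricTensor_comm Y X, inner_neg_left]
  simp
  ring

theorem leviCivita_metric {X Y Z : Π x : M, TangentSpace I x} {x : M}
    (hX : MDiffAt (T% X) x) (hY : MDiffAt (T% Y) x) (hZ : MDiffAt (T% Z) x) :
    mvfderiv I (metricTensor I Y Z) x (X x) =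
      inner ℝ (leviCivita I M Y x (X x)) (Z x) + inner ℝ (Y x) (leviCivita I M Z x (X x)) := by
  rw [real_inner_comm (leviCivita I M Z x (X x)) (Y x), inner_leviCivita hX hY hZ,
    inner_leviCivita hX hZ hY, koszul, koszul, metricTensor_comm Z Y,
    mlieBracket_swap_apply (V := Z) (W := Y), inner_neg_left]
  ring

end Connection

section RiemannSoliton

variable {E : Type*} [NormedAddCommGroup E] [NormedSpace ℝ E] [FiniteDimensional ℝ E]
  {H : Type*} [TopologicalSpace H] (I : ModelWithCorners ℝ E H)
  {M : Type*} [TopologicalSpace M] [ChartedSpace H M] [IsManifold I ∞ M]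
  [RiemannianBundle (fun x : M ↦ TangentSpace I x)]
  [IsContMDiffRiemannianBundle I ∞ E (fun x : M ↦ TangentSpace I x)]

/-- The vector field `∇_X Y`. -/
def nabla (X Y : Π x : M, TangentSpace I x) (x : M) : TangentSpace I x :=
  leviCivita I M Y x (X x)

/-- The curvature `R(X, Y)Z = ∇_X ∇_Y Z - ∇_Y ∇_X Z - ∇_{[X, Y]} Z`. -/
def curvature (X Y Z : Π x : M, TangentSpace I x) (x : M) : TangentSpace I x :=
  nabla I X (nabla I Y Z) x - nabla I Y (nabla I X Z) x - nabla I (mlieBracket I X Y) Z x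

/-- The curvature as a `(0, 4)`-tensor, `R(X, Y, Z, W) = g(R(X, Y)Z, W)`. -/
def riemannTensor (X Y Z W : Π x : M, TangentSpace I x) (x : M) : ℝ :=
  metricTensor I (curvature I X Y Z) W x

/-- The Lie derivative of the metric,
`(𝓛_Z g)(X, Y) = Z(g(X, Y)) - g([Z, X], Y) - g(X, [Z, Y])`. -/
def lieDerivMetric (Z X Y : Π x : M, TangentSpace I x) (x : M) : ℝ :=
  mvfderiv I (metricTensor I X Y) x (Z x)
    - metricTensor I (mlieBracket I Z X) Y x - metricTensor I X (mlieBracket I Z Y) x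

/-- The Kulkarni-Nomizu product of two `(0, 2)`-tensors (given by their action on vector fields). -/
def kulkarniNomizu (P Q : (Π x : M, TangentSpace I x) → (Π x : M, TangentSpace I x) → M → ℝ)
    (X Y Z W : Π x : M, TangentSpace I x) (x : M) : ℝ :=
  P X W x * Q Y Z x + P Y Z x * Q X W x - P X Z x * Q Y W x - P Y W x * Q X Z x

/-- The tensor equation `2R + lam (g ∧ g) + g ∧ 𝓛_Z g = 0`, where `∧` is the Kulkarni-Nomizu
product. A tensor equation is tested at each point on the vector fields that are smooth near it. -/
def SolitonEquation (Z : Π x : M, TangentSpace I x) (lam : M → ℝ) : Prop :=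
  ∀ (x : M) (X Y V W : Π x : M, TangentSpace I x),
    CMDiffAt ∞ (T% X) x → CMDiffAt ∞ (T% Y) x → CMDiffAt ∞ (T% V) x → CMDiffAt ∞ (T% W) x →
    2 * riemannTensor I X Y V W x
      + lam x * kulkarniNomizu I (metricTensor I) (metricTensor I) X Y V W x
      + kulkarniNomizu I (metricTensor I) (lieDerivMetric I Z) X Y V W x = 0

/-- The metric of `M` is an almost Riemann soliton with potential vector field `Z` and soliton
function `lam`. -/
structure IsAlmostRiemannSoliton (Z : Π x : M, TangentSpace I x) (lam : M → ℝ) : Prop where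
  smooth_field : CMDiff ∞ (T% Z)
  smooth_function : CMDiff ∞ lam
  equation : SolitonEquation I Z lam

/-- The metric of `M` is a Riemann soliton with potential vector field `Z` and soliton
constant `c`. -/
structure IsRiemannSoliton (Z : Π x : M, TangentSpace I x) (c : ℝ) : Prop where
  smooth_field : CMDiff ∞ (T% Z)
  equation : SolitonEquation I Z (fun _ ↦ c)

end RiemannSoliton

section AlmostContactMetric

variable {E : Type*} [NormedAddCommGroup E] [NormedSpace ℝ E] [FiniteDimensional ℝ E]
  {H : Type*} [TopologicalSpace H] (I : ModelWithCorners ℝ E H)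
  (M : Type*) [TopologicalSpace M] [ChartedSpace H M] [IsManifold I ∞ M]
  [RiemannianBundle (fun x : M ↦ TangentSpace I x)]
  [IsContMDiffRiemannianBundle I ∞ E (fun x : M ↦ TangentSpace I x)]

/-- An almost contact metric structure `(φ, ξ, η, g)` on `M`, where `g` is the given Riemannian
metric of `M`: a smooth `(1, 1)`-tensor field `φ`, a smooth vector field `ξ` and a smooth 1-form
`η` with `φ² = -id + η ⊗ ξ`, `η(ξ) = 1`, `φξ = 0`, `η ∘ φ = 0` and
`g(φX, φY) = g(X, Y) - η(X) η(Y)`. -/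
structure AlmostContactMetricStructure where
  phi : Π x : M, TangentSpace I x →L[ℝ] TangentSpace I x
  xi : Π x : M, TangentSpace I x
  eta : Π x : M, TangentSpace I x →L[ℝ] ℝ
  contMDiff_phi : ContMDiff I (I.prod 𝓘(ℝ, E →L[ℝ] E)) ∞
    (fun x ↦ TotalSpace.mk' (E →L[ℝ] E)
      (E := fun x : M ↦ TangentSpace I x →L[ℝ] TangentSpace I x) x (phi x))
  contMDiff_xi : CMDiff ∞ (T% xi)
  contMDiff_eta : ContMDiff I (I.prod 𝓘(ℝ, E →L[ℝ] ℝ)) ∞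
    (fun x ↦ TotalSpace.mk' (E →L[ℝ] ℝ)
      (E := fun x : M ↦ TangentSpace I x →L[ℝ] Bundle.Trivial M ℝ x) x (eta x))
  phi_phi (x : M) (v : TangentSpace I x) : phi x (phi x v) = -v + eta x v • xi x
  eta_xi (x : M) : eta x (xi x) = 1
  phi_xi (x : M) : phi x (xi x) = 0
  eta_phi (x : M) (v : TangentSpace I x) : eta x (phi x v) = 0
  inner_phi_phi (x : M) (v w : TangentSpace I x) :
    (inner ℝ (phi x v) (phi x w) : ℝ) = inner ℝ v w - eta x v * eta x w

namespace AlmostContactMetricStructure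

variable {I M} (S : AlmostContactMetricStructure I M)

/-- The vector field `φX`. -/
def phiField (X : Π x : M, TangentSpace I x) (x : M) : TangentSpace I x := S.phi x (X x)

/-- The function `η(X)`. -/
def etaFun (X : Π x : M, TangentSpace I x) (x : M) : ℝ := S.eta x (X x)

/-- The Nijenhuis torsion
`[φ, φ](X, Y) = φ²[X, Y] + [φX, φY] - φ[φX, Y] - φ[X, φY]`. -/
def nijenhuis (X Y : Π x : M, TangentSpace I x) (x : M) : TangentSpace I x :=
  S.phi x (S.phi x (mlieBracket I X Y x)) + mlieBracket I (S.phiField X) (S.phiField Y) x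
    - S.phi x (mlieBracket I (S.phiField X) Y x) - S.phi x (mlieBracket I X (S.phiField Y) x)

/-- The exterior derivative `dη`, with the normalization
`2 dη(X, Y) = X(η(Y)) - Y(η(X)) - η([X, Y])` that is customary in contact metric geometry. -/
def dEta (X Y : Π x : M, TangentSpace I x) (x : M) : ℝ :=
  (1 / 2 : ℝ) * (mvfderiv I (S.etaFun Y) x (X x) - mvfderiv I (S.etaFun X) x (Y x)
    - S.eta x (mlieBracket I X Y x))

/-- The structure is normal: `[φ, φ] + 2 dη ⊗ ξ = 0`. -/
def IsNormal : Prop :=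
  ∀ (x : M) (X Y : Π x : M, TangentSpace I x), CMDiffAt ∞ (T% X) x → CMDiffAt ∞ (T% Y) x →
    S.nijenhuis X Y x + (2 * S.dEta X Y x) • S.xi x = 0

/-- The fundamental 2-form `Φ(X, Y) = g(X, φY)`. -/
def fundamentalForm (X Y : Π x : M, TangentSpace I x) : M → ℝ :=
  metricTensor I X (S.phiField Y)

/-- The exterior derivative `dΦ` of the fundamental 2-form, in the same normalization:
`3 dΦ(X, Y, Z)` is the cyclic sum of `X(Φ(Y, Z)) - Φ([X, Y], Z)`. -/
def dFundamentalForm (X Y Z : Π x : M, TangentSpace I x) (x : M) : ℝ :=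
  (1 / 3 : ℝ) * (mvfderiv I (S.fundamentalForm Y Z) x (X x)
    + mvfderiv I (S.fundamentalForm Z X) x (Y x) + mvfderiv I (S.fundamentalForm X Y) x (Z x)
    - S.fundamentalForm (mlieBracket I X Y) Z x - S.fundamentalForm (mlieBracket I Y Z) X x
    - S.fundamentalForm (mlieBracket I Z X) Y x)

/-- The structure is cosymplectic: it is normal, and `η` and `Φ` are closed. -/
structure IsCosymplectic : Prop where
  isNormal : S.IsNormal
  eta_closed : ∀ (x : M) (X Y : Π x : M, TangentSpace I x),
    CMDiffAt ∞ (T% X) x → CMDiffAt ∞ (T% Y) x → S.dEta X Y x = 0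
  fundamentalForm_closed : ∀ (x : M) (X Y Z : Π x : M, TangentSpace I x),
    CMDiffAt ∞ (T% X) x → CMDiffAt ∞ (T% Y) x → CMDiffAt ∞ (T% Z) x →
      S.dFundamentalForm X Y Z x = 0

/-- The endomorphism `X ↦ ∇_X ξ` of the tangent space. -/
def nablaXi (x : M) : TangentSpace I x →L[ℝ] TangentSpace I x := leviCivita I M S.xi x

/-- `α = (1/2) div ξ = (1/2) trace (X ↦ ∇_X ξ)`. -/
def alpha (x : M) : ℝ :=
  (1 / 2 : ℝ) * LinearMap.trace ℝ (TangentSpace I x) (S.nablaXi x).toLinearMap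

/-- `β = (1/2) trace (X ↦ φ(∇_X ξ))`. -/
def beta (x : M) : ℝ :=
  (1 / 2 : ℝ) *
    LinearMap.trace ℝ (TangentSpace I x) ((S.phi x).toLinearMap ∘ₗ (S.nablaXi x).toLinearMap)

end AlmostContactMetricStructure

end AlmostContactMetric

end AlmostContact

end

/-!
Normality of the structure means `𝓛_ξ η = 0` and `𝓛_ξ φ = 0`. Read through the metric, the first
says that `ξ` is geodesic, the second that the symmetric part of `∇ξ` commutes with `φ`. On the
plane `ξ^⊥` of a 3-manifold only the multiples of the identity do so, hence
`∇ξ = α (id - η ⊗ ξ) - β φ`. Since `ξ` is geodesic, the Riccati equation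
`R(X, ξ)ξ = -(∇_ξ A)X - A²X` with `A = ∇ξ` then gives the sectional curvature `β² - α² - ξ(α)` to
every plane through `ξ`, and the soliton equation on such a plane reads `λ = α² - β² + ξ(α) - α`.
-/

noncomputable section

namespace AlmostContact

open Module
open scoped RealInnerProductSpace

section LinearAlgebra

variable {V : Type*} [NormedAddCommGroup V] [InnerProductSpace ℝ V]

/-- A linear almost contact metric structure on a Euclidean space, which is what an almost contact
metric structure induces on each tangent space. The form `η` is encoded as `⟪ξ, ·⟫`, so that the
compatibility with the metric amounts to `φ` being skew. -/
structure IsAlmostContactMetric (φ : V →ₗ[ℝ] V) (ξ : V) : Prop where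
  norm_xi : ‖ξ‖ = 1
  phi_phi (v : V) : φ (φ v) = -v + ⟪ξ, v⟫ • ξ
  inner_phi (v w : V) : ⟪φ v, w⟫ = -⟪v, φ w⟫

theorem exists_norm_eq_one_inner_eq_zero [FiniteDimensional ℝ V] (hV : 1 < finrank ℝ V) (v : V) :
    ∃ e : V, ‖e‖ = 1 ∧ ⟪v, e⟫ = 0 := by
  have hpos : 0 < finrank ℝ (ℝ ∙ v)ᗮ := by
    have hadd := (ℝ ∙ v).finrank_add_finrank_orthogonal
    have hspan : finrank ℝ (ℝ ∙ v) ≤ 1 := by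
      simpa using finrank_span_le_card (R := ℝ) {v}
    omega
  have : Nontrivial (ℝ ∙ v)ᗮ := nontrivial_of_finrank_pos hpos
  obtain ⟨e, he⟩ := exists_norm_eq (ℝ ∙ v)ᗮ zero_le_one
  exact ⟨e, he, Submodule.mem_orthogonal_singleton_iff_inner_right.mp e.2⟩

namespace IsAlmostContactMetric

variable {φ : V →ₗ[ℝ] V} {ξ : V}

theorem inner_self_phi (h : IsAlmostContactMetric φ ξ) (v : V) : ⟪v, φ v⟫ = 0 := by
  have hskew := h.inner_phi v v
  rw [real_inner_comm] at hskew
  linarith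

theorem phi_xi (h : IsAlmostContactMetric φ ξ) : φ ξ = 0 := by
  have hφφ : φ (φ ξ) = 0 := by
    rw [h.phi_phi, real_inner_self_eq_norm_sq, h.norm_xi]
    simp
  rw [← inner_self_eq_zero (𝕜 := ℝ), h.inner_phi, hφφ, inner_zero_right, neg_zero]

theorem inner_xi_phi (h : IsAlmostContactMetric φ ξ) (v : V) : ⟪ξ, φ v⟫ = 0 := by
  rw [← neg_eq_zero, ← h.inner_phi, h.phi_xi, inner_zero_left]

theorem phi_phi_of_inner_eq_zero (h : IsAlmostContactMetric φ ξ) {e : V} (hξe : ⟪ξ, e⟫ = 0) :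
    φ (φ e) = -e := by
  rw [h.phi_phi, hξe, zero_smul, add_zero]

theorem orthonormal_frame (h : IsAlmostContactMetric φ ξ) {e : V} (he : ‖e‖ = 1)
    (hξe : ⟪ξ, e⟫ = 0) : Orthonormal ℝ ![e, φ e, ξ] := by
  have hφe : ‖φ e‖ = 1 := by
    rw [← sq_eq_sq₀ (norm_nonneg _) zero_le_one, ← real_inner_self_eq_norm_sq, h.inner_phi,
      h.phi_phi_of_inner_eq_zero hξe, inner_neg_right, neg_neg, real_inner_self_eq_norm_sq, he]
  simp [orthonormal_vecCons_iff, Fin.forall_fin_succ, he, hφe, h.norm_xi, h.inner_self_phi,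
    real_inner_comm ξ, hξe, h.inner_xi_phi]

theorem exists_orthonormalBasis (h : IsAlmostContactMetric φ ξ) (hV : finrank ℝ V = 3) {e : V}
    (he : ‖e‖ = 1) (hξe : ⟪ξ, e⟫ = 0) :
    ∃ b : OrthonormalBasis (Fin 3) ℝ V, ⇑b = ![e, φ e, ξ] := by
  have hon := h.orthonormal_frame he hξe
  have hcoe := coe_basisOfOrthonormalOfCardEqFinrank hon (by simp [hV])
  exact ⟨(basisOfOrthonormalOfCardEqFinrank hon (by simp [hV])).toOrthonormalBasis
    (hcoe.symm ▸ hon), by rw [Basis.coe_toOrthonormalBasis, hcoe]⟩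

theorem trace_eq (h : IsAlmostContactMetric φ ξ) (hV : finrank ℝ V = 3) {T : V →ₗ[ℝ] V}
    (hTξ : T ξ = 0) {e : V} (he : ‖e‖ = 1) (hξe : ⟪ξ, e⟫ = 0) :
    LinearMap.trace ℝ V T = ⟪e, T e⟫ + ⟪φ e, T (φ e)⟫ := by
  obtain ⟨b, hb⟩ := h.exists_orthonormalBasis hV he hξe
  simp [LinearMap.trace_eq_sum_inner T b, Fin.sum_univ_three, hb, hTξ]

section TransverseEndomorphism

variable {A : V →ₗ[ℝ] V} (hAξ : A ξ = 0) (hξA : ∀ v, ⟪ξ, A v⟫ = 0)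
  (hA : ∀ v, ⟪A v, φ v⟫ + ⟪v, A (φ v)⟫ = 0)
include hAξ hA

theorem inner_apply_self (h : IsAlmostContactMetric φ ξ) (hV : finrank ℝ V = 3) {e : V}
    (he : ‖e‖ = 1) (hξe : ⟪ξ, e⟫ = 0) : ⟪e, A e⟫ = (1 / 2 : ℝ) * LinearMap.trace ℝ V A := by
  have hpolar := hA (e + φ e)
  simp only [map_add, h.phi_phi_of_inner_eq_zero hξe, map_neg, inner_add_left, inner_add_right,
    inner_neg_right] at hpolar
  have he₁ := hA e
  have he₂ := hA (φ e)
  simp only [h.phi_phi_of_inner_eq_zero hξe, map_neg, inner_neg_right] at he₂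
  rw [h.trace_eq hV hAξ he hξe]
  linarith [real_inner_comm e (A e), real_inner_comm (φ e) (A (φ e))]

theorem inner_phi_apply (h : IsAlmostContactMetric φ ξ) (hV : finrank ℝ V = 3) {e : V}
    (he : ‖e‖ = 1) (hξe : ⟪ξ, e⟫ = 0) :
    ⟪φ e, A e⟫ = -((1 / 2 : ℝ) * LinearMap.trace ℝ V (φ ∘ₗ A)) := by
  have htrace := h.trace_eq hV (T := φ ∘ₗ A) (by simp [hAξ]) he hξe
  have h₁ := h.inner_phi e (A e)
  have h₂ := h.inner_phi (φ e) (A (φ e))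
  rw [h.phi_phi_of_inner_eq_zero hξe, inner_neg_left] at h₂
  rw [LinearMap.comp_apply, LinearMap.comp_apply] at htrace
  linarith [hA e, real_inner_comm (φ e) (A e)]

include hξA

theorem apply_eq_of_norm_eq_one (h : IsAlmostContactMetric φ ξ) (hV : finrank ℝ V = 3) {e : V}
    (he : ‖e‖ = 1) (hξe : ⟪ξ, e⟫ = 0) :
    A e = ((1 / 2 : ℝ) * LinearMap.trace ℝ V A) • e
      - ((1 / 2 : ℝ) * LinearMap.trace ℝ V (φ ∘ₗ A)) • φ e := by
  obtain ⟨b, hb⟩ := h.exists_orthonormalBasis hV he hξe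
  rw [← b.sum_repr' (A e), Fin.sum_univ_three, hb]
  simp [h.inner_apply_self hAξ hA hV he hξe, h.inner_phi_apply hAξ hA hV he hξe, hξA,
    sub_eq_add_neg]

theorem apply_eq (h : IsAlmostContactMetric φ ξ) (hV : finrank ℝ V = 3) (v : V) :
    A v = ((1 / 2 : ℝ) * LinearMap.trace ℝ V A) • (v - ⟪ξ, v⟫ • ξ)
      - ((1 / 2 : ℝ) * LinearMap.trace ℝ V (φ ∘ₗ A)) • φ v := by
  set w := v - ⟪ξ, v⟫ • ξ with hw
  have hξw : ⟪ξ, w⟫ = 0 := by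
    rw [hw, inner_sub_right, inner_smul_right, real_inner_self_eq_norm_sq, h.norm_xi]
    ring
  have hAw : A v = A w := by simp [hw, hAξ]
  have hφw : φ v = φ w := by simp [hw, h.phi_xi]
  rcases eq_or_ne w 0 with hw0 | hw0
  · simp [hAw, hφw, hw0]
  have hunit := h.apply_eq_of_norm_eq_one hAξ hξA hA hV (norm_smul_inv_norm (𝕜 := ℝ) hw0)
    (by rw [inner_smul_right, hξw, mul_zero])
  rw [hAw, hφw]
  simp only [map_smul] at hunit
  rw [smul_comm _ _ w, smul_comm _ _ (φ w), ← smul_sub] at hunit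
  exact smul_right_injective V (by simpa using hw0) hunit

end TransverseEndomorphism

end IsAlmostContactMetric

end LinearAlgebra

section Riemannian

variable {E : Type*} [NormedAddCommGroup E] [NormedSpace ℝ E] [FiniteDimensional ℝ E]
  {H : Type*} [TopologicalSpace H] {I : ModelWithCorners ℝ E H}
  {M : Type*} [TopologicalSpace M] [ChartedSpace H M] [IsManifold I ∞ M]
  [RiemannianBundle (fun x : M ↦ TangentSpace I x)]
  [IsContMDiffRiemannianBundle I ∞ E (fun x : M ↦ TangentSpace I x)]
  {X Y Z : Π x : M, TangentSpace I x} {x : M}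

theorem inner_leviCivita_eq_zero_of_metricTensor_self_const {c : ℝ} (hZ : MDiffAt (T% Z) x)
    (hc : metricTensor I Z Z = fun _ ↦ c) (v : TangentSpace I x) :
    ⟪Z x, leviCivita I M Z x v⟫ = 0 := by
  have hmetric := leviCivita_metric (FiberBundle.mdifferentiableAt_extend I E v) hZ hZ
  rw [hc, mvfderiv_const, FiberBundle.extend_apply_self, real_inner_comm (Z x), zero_apply]
    at hmetric
  linarith

theorem lieDerivMetric_eq_inner_leviCivita (hX : MDiffAt (T% X) x) (hY : MDiffAt (T% Y) x)
    (hZ : MDiffAt (T% Z) x) :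
    lieDerivMetric I Z X Y x =
      ⟪leviCivita I M Z x (X x), Y x⟫ + ⟪X x, leviCivita I M Z x (Y x)⟫ := by
  rw [lieDerivMetric, leviCivita_metric hZ hX hY, metricTensor, metricTensor,
    ← leviCivita_torsion_free hZ hX, ← leviCivita_torsion_free hZ hY, inner_sub_left,
    inner_sub_right]
  ring

/-- The Riccati equation `R(X, Z)Z = -(∇_Z A)X - A²X` of `A = ∇Z`, paired with `X`. -/
theorem riemannTensor_of_nabla_self_eq_zero (hgeodesic : nabla I Z Z = 0) (hX : MDiffAt (T% X) x)
    (hZ : MDiffAt (T% Z) x) (hXZ : MDiffAt (T% (nabla I X Z)) x) :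
    riemannTensor I X Z Z X x =
      -mvfderiv I (metricTensor I (nabla I X Z) X) x (Z x)
        + (⟪leviCivita I M Z x (X x), nabla I Z X x⟫ + ⟪X x, leviCivita I M Z x (nabla I Z X x)⟫)
        - ⟪leviCivita I M Z x (leviCivita I M Z x (X x)), X x⟫ := by
  have hcurv : curvature I X Z Z x = -leviCivita I M (nabla I X Z) x (Z x)
      - leviCivita I M Z x (leviCivita I M Z x (X x) - leviCivita I M X x (Z x)) := by
    rw [leviCivita_torsion_free hX hZ, curvature, hgeodesic]
    simp [nabla]
  rw [riemannTensor, metricTensor, hcurv, leviCivita_metric hZ hXZ hX]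
  simp only [nabla, map_sub, inner_sub_left, inner_neg_left,
    real_inner_comm (X x) (leviCivita I M Z x _)]
  ring

end Riemannian

namespace AlmostContactMetricStructure

variable {E : Type*} [NormedAddCommGroup E] [NormedSpace ℝ E]
  {H : Type*} [TopologicalSpace H] {I : ModelWithCorners ℝ E H}
  {M : Type*} [TopologicalSpace M] [ChartedSpace H M] [IsManifold I ∞ M]
  [RiemannianBundle (fun x : M ↦ TangentSpace I x)]
  (S : AlmostContactMetricStructure I M) {X Y : Π x : M, TangentSpace I x} {x : M}

theorem inner_xi (x : M) (v : TangentSpace I x) : ⟪S.xi x, v⟫ = S.eta x v := by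
  have h := S.inner_phi_phi x (S.xi x) v
  rw [S.phi_xi, inner_zero_left, S.eta_xi] at h
  linarith

theorem isAlmostContactMetric (x : M) :
    IsAlmostContactMetric (S.phi x).toLinearMap (S.xi x) where
  norm_xi := by
    rw [← sq_eq_sq₀ (norm_nonneg _) zero_le_one, ← real_inner_self_eq_norm_sq, S.inner_xi,
      S.eta_xi, one_pow]
  phi_phi v := by simpa [S.inner_xi] using S.phi_phi x v
  inner_phi v w := by
    have h := S.inner_phi_phi x v (S.phi x w)
    rw [S.phi_phi, S.eta_phi, inner_add_right, inner_neg_right, inner_smul_right,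
      real_inner_comm (S.xi x) (S.phi x v), S.inner_xi, S.eta_phi] at h
    simp only [ContinuousLinearMap.coe_coe]
    linarith

theorem inner_self_phi (x : M) (v : TangentSpace I x) : ⟪v, S.phi x v⟫ = 0 :=
  (S.isAlmostContactMetric x).inner_self_phi v

theorem metricTensor_xi : metricTensor I S.xi X = S.etaFun X :=
  funext fun x ↦ S.inner_xi x (X x)

theorem etaFun_xi : S.etaFun S.xi = fun _ ↦ 1 := funext S.eta_xi

theorem phiField_xi : S.phiField S.xi = 0 := funext S.phi_xi

theorem eq_zero_of_phi_eq_zero_of_eta_eq_zero {v : TangentSpace I x} (hφ : S.phi x v = 0)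
    (hη : S.eta x v = 0) : v = 0 := by
  simpa [hφ, hη] using S.phi_phi x v

theorem contMDiffAt_phiField (hX : CMDiffAt ∞ (T% X) x) : CMDiffAt ∞ (T% (S.phiField X)) x :=
  (S.contMDiff_phi x).clm_bundle_apply hX

theorem mdiffAt_xi (x : M) : MDiffAt (T% S.xi) x :=
  (S.contMDiff_xi x).mdifferentiableAt (by simp)

theorem two_mul_dEta_xi (X : Π x : M, TangentSpace I x) (x : M) :
    2 * S.dEta S.xi X x =
      mvfderiv I (S.etaFun X) x (S.xi x) - S.eta x (mlieBracket I S.xi X x) := by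
  rw [dEta, S.etaFun_xi, mvfderiv_const, zero_apply]
  ring

theorem nijenhuis_xi (X : Π x : M, TangentSpace I x) (x : M) :
    S.nijenhuis S.xi X x =
      S.phi x (S.phi x (mlieBracket I S.xi X x) - mlieBracket I S.xi (S.phiField X) x) := by
  rw [nijenhuis, S.phiField_xi, mlieBracket_zero_left, mlieBracket_zero_left, map_sub]
  simp

section Normal

variable {S} (hS : S.IsNormal)
include hS

theorem IsNormal.mvfderiv_etaFun_xi (hX : CMDiffAt ∞ (T% X) x) :
    mvfderiv I (S.etaFun X) x (S.xi x) = S.eta x (mlieBracket I S.xi X x) := by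
  have hη := congrArg (S.eta x) (hS x S.xi X (S.contMDiff_xi x) hX)
  rw [S.nijenhuis_xi, S.two_mul_dEta_xi, map_add, S.eta_phi, map_smul, S.eta_xi, map_zero] at hη
  simpa [sub_eq_zero] using hη

theorem IsNormal.mlieBracket_xi_phiField (hX : CMDiffAt ∞ (T% X) x) :
    mlieBracket I S.xi (S.phiField X) x = S.phi x (mlieBracket I S.xi X x) := by
  have hη : S.eta x (mlieBracket I S.xi (S.phiField X) x) = 0 := by
    have hηφ : S.etaFun (S.phiField X) = fun _ ↦ 0 := funext fun y ↦ S.eta_phi y (X y)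
    rw [← hS.mvfderiv_etaFun_xi (S.contMDiffAt_phiField hX), hηφ, mvfderiv_const, zero_apply]
  have hφ := hS x S.xi X (S.contMDiff_xi x) hX
  rw [S.nijenhuis_xi, S.two_mul_dEta_xi, hS.mvfderiv_etaFun_xi hX, sub_self, zero_smul,
    add_zero] at hφ
  refine (sub_eq_zero.mp (S.eq_zero_of_phi_eq_zero_of_eta_eq_zero hφ ?_)).symm
  rw [map_sub, S.eta_phi, hη, sub_self]

theorem IsNormal.lieDerivMetric_xi_xi (hX : CMDiffAt ∞ (T% X) x) :
    lieDerivMetric I S.xi S.xi X x = 0 := by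
  rw [lieDerivMetric, S.metricTensor_xi, S.metricTensor_xi, hS.mvfderiv_etaFun_xi hX,
    mlieBracket_self]
  simp [metricTensor, etaFun]

theorem IsNormal.lieDerivMetric_xi_phiField (hX : CMDiffAt ∞ (T% X) x) :
    lieDerivMetric I S.xi X (S.phiField X) x = 0 := by
  have hconst : metricTensor I X (S.phiField X) = fun _ ↦ 0 :=
    funext fun y ↦ S.inner_self_phi y (X y)
  have hskew := (S.isAlmostContactMetric x).inner_phi (X x) (mlieBracket I S.xi X x)
  rw [ContinuousLinearMap.coe_coe, real_inner_comm] at hskew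
  rw [lieDerivMetric, hconst, mvfderiv_const, zero_apply, metricTensor, metricTensor, phiField,
    hS.mlieBracket_xi_phiField hX]
  linarith

end Normal

variable [FiniteDimensional ℝ E]
  [IsContMDiffRiemannianBundle I ∞ E (fun x : M ↦ TangentSpace I x)]

theorem mdiffAt_etaFun (hX : MDiffAt (T% X) x) : MDiffAt (S.etaFun X) x :=
  S.metricTensor_xi ▸ mdiffAt_metricTensor (S.mdiffAt_xi x) hX

theorem inner_xi_nablaXi (x : M) (v : TangentSpace I x) : ⟪S.xi x, S.nablaXi x v⟫ = 0 :=
  inner_leviCivita_eq_zero_of_metricTensor_self_const (S.mdiffAt_xi x)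
    (S.metricTensor_xi.trans S.etaFun_xi) v

theorem lieDerivMetric_xi_eq_inner_nablaXi (hX : MDiffAt (T% X) x) (hY : MDiffAt (T% Y) x) :
    lieDerivMetric I S.xi X Y x =
      ⟪S.nablaXi x (X x), Y x⟫ + ⟪X x, S.nablaXi x (Y x)⟫ :=
  lieDerivMetric_eq_inner_leviCivita hX hY (S.mdiffAt_xi x)

namespace IsNormal

variable {S} (hS : S.IsNormal)
include hS

theorem nablaXi_xi (x : M) : S.nablaXi x (S.xi x) = 0 := by
  refine ext_inner_right ℝ fun w ↦ ?_
  have hW := FiberBundle.contMDiffAt_extend (k := ∞) I E w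
  have hlie := S.lieDerivMetric_xi_eq_inner_nablaXi (S.mdiffAt_xi x)
    (hW.mdifferentiableAt (by simp))
  rw [hS.lieDerivMetric_xi_xi hW, S.inner_xi_nablaXi, FiberBundle.extend_apply_self, add_zero]
    at hlie
  rw [← hlie, inner_zero_left]

theorem inner_nablaXi_phi_add (x : M) (v : TangentSpace I x) :
    ⟪S.nablaXi x v, S.phi x v⟫ + ⟪v, S.nablaXi x (S.phi x v)⟫ = 0 := by
  have hX := FiberBundle.contMDiffAt_extend (k := ∞) I E v
  have hlie := S.lieDerivMetric_xi_eq_inner_nablaXi (hX.mdifferentiableAt (by simp))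
    ((S.contMDiffAt_phiField hX).mdifferentiableAt (by simp))
  rw [hS.lieDerivMetric_xi_phiField hX, phiField, FiberBundle.extend_apply_self] at hlie
  exact hlie.symm

variable (hE : finrank ℝ E = 3)
include hE

theorem nablaXi_apply (x : M) (v : TangentSpace I x) :
    S.nablaXi x v = S.alpha x • (v - S.eta x v • S.xi x) - S.beta x • S.phi x v := by
  have h := (S.isAlmostContactMetric x).apply_eq (A := (S.nablaXi x).toLinearMap)
    (hS.nablaXi_xi x) (S.inner_xi_nablaXi x) (hS.inner_nablaXi_phi_add x) hE v
  rwa [S.inner_xi] at h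

theorem nabla_xi : nabla I X S.xi = S.alpha • (X - S.etaFun X • S.xi) - S.beta • S.phiField X :=
  funext fun x ↦ hS.nablaXi_apply hE x (X x)

theorem mdiffAt_nabla_xi (hα : MDiffAt S.alpha x) (hβ : MDiffAt S.beta x)
    (hX : CMDiffAt ∞ (T% X) x) : MDiffAt (T% (nabla I X S.xi)) x := by
  have hXd : MDiffAt (T% X) x := hX.mdifferentiableAt (by simp)
  rw [hS.nabla_xi hE]
  exact mdifferentiableAt_sub_section
    (hα.smul_section (mdifferentiableAt_sub_section hXd
      ((S.mdiffAt_etaFun hXd).smul_section (S.mdiffAt_xi x))))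
    (hβ.smul_section ((S.contMDiffAt_phiField hX).mdifferentiableAt (by simp)))

theorem inner_nablaXi_self (x : M) (v : TangentSpace I x) :
    ⟪S.nablaXi x v, v⟫ = S.alpha x * (⟪v, v⟫ - S.eta x v ^ 2) := by
  rw [hS.nablaXi_apply hE, inner_sub_left, real_inner_smul_left, real_inner_smul_left,
    inner_sub_left, real_inner_smul_left, S.inner_xi, real_inner_comm v (S.phi x v),
    S.inner_self_phi]
  ring

theorem inner_nablaXi_add_inner_nablaXi (x : M) (v w : TangentSpace I x) :
    ⟪S.nablaXi x v, w⟫ + ⟪v, S.nablaXi x w⟫ =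
      2 * S.alpha x * (⟪v, w⟫ - S.eta x v * S.eta x w) := by
  have hvw := hS.inner_nablaXi_self hE x (v + w)
  simp only [map_add, inner_add_left, inner_add_right, hS.inner_nablaXi_self hE x] at hvw
  rw [real_inner_comm v w, real_inner_comm v (S.nablaXi x w)] at hvw
  linear_combination hvw

theorem inner_nablaXi_nablaXi_self (x : M) (v : TangentSpace I x) :
    ⟪S.nablaXi x (S.nablaXi x v), v⟫ =
      (S.alpha x ^ 2 - S.beta x ^ 2) * (⟪v, v⟫ - S.eta x v ^ 2) := by
  simp only [hS.nablaXi_apply hE, map_sub, map_smul, S.eta_phi, S.eta_xi, S.phi_phi, S.phi_xi,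
    inner_sub_left, inner_add_left, inner_neg_left, real_inner_smul_left, S.inner_xi,
    real_inner_comm v (S.phi x v), S.inner_self_phi, smul_eq_mul, smul_zero, inner_zero_left]
  ring

theorem lieDerivMetric_xi (hX : MDiffAt (T% X) x) (hY : MDiffAt (T% Y) x) :
    lieDerivMetric I S.xi X Y x =
      2 * S.alpha x * (⟪X x, Y x⟫ - S.eta x (X x) * S.eta x (Y x)) := by
  rw [S.lieDerivMetric_xi_eq_inner_nablaXi hX hY]
  exact hS.inner_nablaXi_add_inner_nablaXi hE x (X x) (Y x)

theorem mvfderiv_inner_nabla_xi_self (hα : MDiffAt S.alpha x) (hX : MDiffAt (T% X) x) :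
    mvfderiv I (metricTensor I (nabla I X S.xi) X) x (S.xi x) =
      mvfderiv I S.alpha x (S.xi x) * (⟪X x, X x⟫ - S.eta x (X x) ^ 2)
        + 2 * S.alpha x * (⟪X x, nabla I S.xi X x⟫
          - S.eta x (X x) * S.eta x (nabla I S.xi X x)) := by
  have hξ := S.mdiffAt_xi x
  have hη := S.mdiffAt_etaFun hX
  have hg := mdiffAt_metricTensor hX hX
  have hfun : metricTensor I (nabla I X S.xi) X =
      S.alpha * (metricTensor I X X - S.etaFun X * S.etaFun X) :=
    funext fun y ↦ (hS.inner_nablaXi_self hE y (X y)).trans (by rw [sq]; rfl)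
  have hξη : mvfderiv I (S.etaFun X) x (S.xi x) = S.eta x (nabla I S.xi X x) := by
    have hmetric := leviCivita_metric hξ hξ hX
    have hgeodesic : leviCivita I M S.xi x (S.xi x) = 0 := hS.nablaXi_xi x
    rwa [S.metricTensor_xi, hgeodesic, inner_zero_left, zero_add, S.inner_xi] at hmetric
  rw [hfun, mvfderiv_mul hα (hg.sub (hη.mul hη)), mvfderiv_sub hg (hη.mul hη),
    mvfderiv_mul hη hη]
  simp only [add_apply, sub_apply, smul_apply, smul_eq_mul, leviCivita_metric hξ hX hX, hξη,
    Pi.sub_apply, Pi.mul_apply, metricTensor, etaFun, nabla, real_inner_comm (X x)]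
  ring

theorem riemannTensor_xi (hα : MDiffAt S.alpha x) (hβ : MDiffAt S.beta x)
    (hX : CMDiffAt ∞ (T% X) x) :
    riemannTensor I X S.xi S.xi X x =
      (S.beta x ^ 2 - S.alpha x ^ 2 - mvfderiv I S.alpha x (S.xi x))
        * (⟪X x, X x⟫ - S.eta x (X x) ^ 2) := by
  have hXd : MDiffAt (T% X) x := hX.mdifferentiableAt (by simp)
  have hgeodesic : nabla I S.xi S.xi = 0 := funext hS.nablaXi_xi
  rw [riemannTensor_of_nabla_self_eq_zero hgeodesic hXd (S.mdiffAt_xi x)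
    (hS.mdiffAt_nabla_xi hE hα hβ hX), hS.mvfderiv_inner_nabla_xi_self hE hα hXd]
  have hsymm := hS.inner_nablaXi_add_inner_nablaXi hE x (X x) (nabla I S.xi X x)
  have hsq := hS.inner_nablaXi_nablaXi_self hE x (X x)
  rw [nablaXi] at hsymm hsq
  rw [hsymm, hsq]
  ring

theorem soliton_function_eq {lam : M → ℝ} (hlam : SolitonEquation I S.xi lam)
    (hα : MDiffAt S.alpha x) (hβ : MDiffAt S.beta x) :
    lam x = S.alpha x ^ 2 - S.beta x ^ 2 + mvfderiv I S.alpha x (S.xi x) - S.alpha x := by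
  obtain ⟨e, he, hξe⟩ := exists_norm_eq_one_inner_eq_zero (V := TangentSpace I x)
    (hE.symm ▸ (by norm_num : 1 < 3)) (S.xi x)
  have hηe : S.eta x e = 0 := by rw [← S.inner_xi, hξe]
  have hee : ⟪e, e⟫ = 1 := by rw [real_inner_self_eq_norm_sq, he, one_pow]
  have hξξ : ⟪S.xi x, S.xi x⟫ = 1 := by rw [S.inner_xi, S.eta_xi]
  have hX := FiberBundle.contMDiffAt_extend (k := ∞) I E e
  have hXd := hX.mdifferentiableAt (by simp)
  have hξ := S.mdiffAt_xi x
  have hplane := hlam x _ S.xi S.xi _ hX (S.contMDiff_xi x) (S.contMDiff_xi x) hX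
  simp only [hS.riemannTensor_xi hE hα hβ hX, kulkarniNomizu, hS.lieDerivMetric_xi hE hXd hXd,
    hS.lieDerivMetric_xi hE hξ hξ, hS.lieDerivMetric_xi hE hXd hξ, hS.lieDerivMetric_xi hE hξ hXd,
    metricTensor, FiberBundle.extend_apply_self, real_inner_comm (S.xi x) e, hee, hξe, hξξ, hηe,
    S.eta_xi] at hplane
  linarith

end IsNormal

end AlmostContactMetricStructure

end AlmostContact

end

theorem corollary4p1_general {E : Type*} [NormedAddCommGroup E] [NormedSpace ℝ E]
    [FiniteDimensional ℝ E] {H : Type*} [TopologicalSpace H] {I : ModelWithCorners ℝ E H}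
    {M : Type*} [TopologicalSpace M] [ChartedSpace H M] [IsManifold I ∞ M]
    [RiemannianBundle (fun x : M ↦ TangentSpace I x)]
    [IsContMDiffRiemannianBundle I ∞ E (fun x : M ↦ TangentSpace I x)]
    (hE : Module.finrank ℝ E = 3) {S : AlmostContact.AlmostContactMetricStructure I M}
    (hS : S.IsNormal) {a b : ℝ} (ha : ∀ x, S.alpha x = a) (hb : ∀ x, S.beta x = b) {lam : M → ℝ}
    (hlam : AlmostContact.SolitonEquation I S.xi lam) :
    (∀ x, lam x = a ^ 2 - b ^ 2 - a) ∧
      AlmostContact.IsRiemannSoliton I S.xi (a ^ 2 - b ^ 2 - a) := by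
  have hα : S.alpha = fun _ ↦ a := funext ha
  have hβ : S.beta = fun _ ↦ b := funext hb
  have hconst (x : M) : lam x = a ^ 2 - b ^ 2 - a := by
    simpa [hα, hβ, mvfderiv_const] using hS.soliton_function_eq hE hlam
      (hα ▸ mdifferentiableAt_const) (hβ ▸ mdifferentiableAt_const)
  exact ⟨hconst, S.contMDiff_xi, funext hconst ▸ hlam⟩

theorem corollary4p1
    (M : Type*) [TopologicalSpace M] [ChartedSpace (EuclideanSpace ℝ (Fin 3)) M]
    [IsManifold (𝓡 3) ∞ M]
    [RiemannianBundle (fun x : M ↦ TangentSpace (𝓡 3) x)]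
    [IsContMDiffRiemannianBundle (𝓡 3) ∞ (EuclideanSpace ℝ (Fin 3))
      (fun x : M ↦ TangentSpace (𝓡 3) x)]
    (S : AlmostContact.AlmostContactMetricStructure (𝓡 3) M)
    (hnormal : S.IsNormal) (hcosymplectic : ¬ S.IsCosymplectic)
    (halpha : ∃ a : ℝ, ∀ x : M, S.alpha x = a) (hbeta : ∃ b : ℝ, ∀ x : M, S.beta x = b)
    (lam : M → ℝ) (hsoliton : AlmostContact.IsAlmostRiemannSoliton (𝓡 3) S.xi lam) :
    ∃ c : ℝ, (∀ x : M, lam x = c) ∧ AlmostContact.IsRiemannSoliton (𝓡 3) S.xi c := by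
  obtain ⟨a, ha⟩ := halpha
  obtain ⟨b, hb⟩ := hbeta
  exact ⟨_, corollary4p1_general finrank_euclideanSpace_fin hnormal ha hb hsoliton.equation⟩
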